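/- Let $d\ge 1$, $\rho>0$, and let $C:\mathbb R^d\to\mathbb R$ satisfy condition $\mathcal K(\rho)$: $C$ is continuous, symmetric ($C(-x)=C(x)$), belongs to $L^2(\mathbb R^d)$, $C(0)=\rho$, and $0\le \mathcal F(C)\le 1$ a.e., where $\mathcal F(h)(t)=\int h(x)e^{2i\pi x\cdot t}dx$ is extended to $L^2$ by Plancherel's theorem. Let $\mathbf X$ be an isotropic (law invariant under rotations about the origin) simple locally finite point process on $\mathbb R^d$ that is determinantal with kernel $C$: for every $k\ge1$ its $k$-th factorial moment measure $$\alpha^{(k)}(D)=\mathbb E\,\#\{(x_1,\dots,x_k)\in\mathbf X^k\cap D:\ x_i \text{ pairwise distinct}\}$$ has Lebesgue density $\det(C(x_i-x_j))_{1\le i,j\le k}$. The $k$-th factorial cumulant measure $\gamma_{[k]}$ is given for bounded Borel $A_1,\dots,A_k$ by $$\gamma_{[k]}\Big(\prod_{i=1}^k A_i\Big)=\sum_{j=1}^k(-1)^{j-1}(j-1)!\sum_{\{B_1,\dots,B_j\}}\prod_{i=1}^j\alpha^{(|B_i|)}\Big(\prod_{l\in B_i}A_l\Big),$$ the inner sum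 being over partitions of $\{1,\dots,k\}$ into $j$ non-empty blocks, and the reduced measure $\gamma^{red}_{[k]}$, a locally finite signed measure on $\mathbb R^{d(k-1)}$, is defined by $\gamma_{[k]}(\prod_{i=1}^k A_i)=\int_{A_k}\gamma^{red}_{[k]}(\prod_{i=1}^{k-1}(A_i-x))\,dx$ for bounded Borel $A_1,\dots,A_k$. Then $\gamma^{red}_{[3]}$ and $\gamma^{red}_{[4]}$ exist and have Lebesgue densities $c^{red}_{[3]}$, $c^{red}_{[4]}$, which are given (almost everywhere, for any version) by $$c^{red}_{[3]}(u,v)=2\,C(u)C(v)C(v-u),$$ $$c^{red}_{[4]}(u,v,w)=-2\big[C(u)C(v)C(u-w)C(v-w)+C(u)C(w)C(u-v)C(v-w)+C(v)C(w)C(u-v)C(u-w)\big].$$ Moreover, for every compact set $K\subset\mathbb R$ and every $\epsilon>0$, with $K^{\oplus\epsilon}=K+[-\epsilon,\epsilon]$, $$\sup_{u,v\in\mathbb R^d,\ |u|,|v|\in K^{\oplus\epsilon}}\big|c^{red}_{[3]}(u,v)\big|<\infty \quad\text{and}\quad \sup_{u,v\in\mathbb R^d,\ |u|,|v|\in K^{\oplus\epsilon}}\int_{\mathbb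 R^d}\big|c^{red}_{[4]}(u,w,v+w)\big|\,dw<\infty .$$ Here the suprema are true suprema over all $(u,v)$ for the versions given by the above formulas, and essential suprema over $(u,v)$ for arbitrary versions of the densities. -/

import Mathlib

open MeasureTheory
open scoped Pointwise ENNReal NNReal FourierTransform

noncomputable section

/-- Euclidean space `ℝ^d`. -/
abbrev Euc (d : ℕ) : Type := EuclideanSpace ℝ (Fin d)

/-- A (simple) point process on `ℝ^d` on the sample space `Ω`: a random locally finite set of
points, measurable for the σ-algebra generated by the counts of points in bounded Borel sets. -/
structure PointProcess (Ω : Type*) [MeasurableSpace Ω] (d : ℕ) where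
  /-- The random configuration of points. -/
  points : Ω → Set (Euc d)
  finite_inter : ∀ ω, ∀ B : Set (Euc d), Bornology.IsBounded B → (points ω ∩ B).Finite
  measurable_count : ∀ B : Set (Euc d), MeasurableSet B → Bornology.IsBounded B →
    Measurable fun ω => (points ω ∩ B).encard

/-- The factorial moment measure `α^(k)` of order `k`, evaluated at `D ⊆ (ℝ^d)^k`: the expected
number of `k`-tuples of pairwise distinct points of the process that lie in `D`. -/
def factorialMoment {Ω : Type*} [MeasurableSpace Ω] {d : ℕ} (P : Measure Ω)
    (X : PointProcess Ω d) (k : ℕ) (D : Set (Fin k → Euc d)) : ℝ≥0∞ :=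
  ∫⁻ ω, (({x : Fin k → Euc d | Function.Injective x ∧ ∀ i, x i ∈ X.points ω} ∩ D).encard : ℝ≥0∞)
    ∂P

/-- `f` is (a version of) the joint intensity of order `k`: the density of the factorial moment
measure of order `k` with respect to Lebesgue measure on `(ℝ^d)^k`. -/
def IsJointIntensity {Ω : Type*} [MeasurableSpace Ω] {d : ℕ} (P : Measure Ω)
    (X : PointProcess Ω d) (k : ℕ) (f : (Fin k → Euc d) → ℝ) : Prop :=
  AEMeasurable f volume ∧ (∀ᵐ x, 0 ≤ f x) ∧
    ∀ D : Set (Fin k → Euc d), MeasurableSet D →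
      factorialMoment P X k D = ∫⁻ x in D, ENNReal.ofReal (f x)

/-- `X ∼ DPP(C)`: for every `k ≥ 1` the joint intensity of order `k` is
`det (C (x_i - x_j))_{i, j}`, almost everywhere. -/
def IsDPP {Ω : Type*} [MeasurableSpace Ω] {d : ℕ} (P : Measure Ω)
    (X : PointProcess Ω d) (C : Euc d → ℝ) : Prop :=
  ∀ k : ℕ, 1 ≤ k →
    IsJointIntensity P X k fun x => (Matrix.of fun i j : Fin k => C (x i - x j)).det

/-- The law of the point process is invariant under rotations about the origin (the law being
determined by the joint laws of finitely many counts in bounded Borel sets). -/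
def IsIsotropic {Ω : Type*} [MeasurableSpace Ω] {d : ℕ} (P : Measure Ω)
    (X : PointProcess Ω d) : Prop :=
  ∀ R : Euc d ≃ₗᵢ[ℝ] Euc d,
    LinearMap.det (R.toLinearEquiv : Euc d →ₗ[ℝ] Euc d) = 1 →
    ∀ (n : ℕ) (B : Fin n → Set (Euc d)),
      (∀ i, MeasurableSet (B i)) → (∀ i, Bornology.IsBounded (B i)) →
      P.map (fun ω i => (X.points ω ∩ B i).encard) =
        P.map (fun ω i => (R '' X.points ω ∩ B i).encard)

/-- Condition `𝒦(ρ)`: `C` is a symmetric continuous real-valued function in `L²(ℝ^d)` with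
`C 0 = ρ` and `0 ≤ ℱ(C) ≤ 1` a.e., where `ℱ(h)(t) = ∫ h(x) exp(2iπ x·t) dx`, extended to `L²`
by Plancherel's theorem. With this sign of the exponent `ℱ` is Mathlib's `𝓕⁻`. -/
structure ConditionK {d : ℕ} (C : Euc d → ℝ) (ρ : ℝ) : Prop where
  symm : ∀ x, C (-x) = C x
  continuous : Continuous C
  memLp : MemLp (fun x => (C x : ℂ)) 2 (volume : Measure (Euc d))
  apply_zero : C 0 = ρ
  fourier : ∀ᵐ t : Euc d, ∃ r : ℝ, 0 ≤ r ∧ r ≤ 1 ∧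
    (𝓕⁻ (memLp.toLp fun x => (C x : ℂ)) : Lp ℂ 2 (volume : Measure (Euc d))) t = (r : ℂ)

/-- The value `γ_[k](A_1 × ⋯ × A_k)` of the `k`-th order factorial cumulant moment measure:
`∑_{j=1}^k (-1)^(j-1) (j-1)! ∑_{partitions of {1..k} into j blocks} ∏_{blocks b}
α^(|b|) (∏_{i ∈ b} A_i)`. -/
def factorialCumulant {Ω : Type*} [MeasurableSpace Ω] {d : ℕ} (P : Measure Ω)
    (X : PointProcess Ω d) (k : ℕ) (A : Fin k → Set (Euc d)) : ℝ :=
  ∑ j ∈ Finset.Icc 1 k, (-1 : ℝ) ^ (j - 1) * ((j - 1).factorial : ℝ) *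
    ∑ π : Finpartition (Finset.univ : Finset (Fin k)) with π.parts.card = j,
      ∏ b ∈ π.parts,
        (factorialMoment P X b.card
          (Set.univ.pi fun i : Fin b.card => A (b.orderEmbOfFin rfl i))).toReal

/-- A locally finite signed measure, given through its Hahn–Jordan decomposition. -/
structure LocFinSignedMeasure (α : Type*) [TopologicalSpace α] [MeasurableSpace α] where
  pos : Measure α
  neg : Measure α
  locFin_pos : IsLocallyFiniteMeasure pos
  locFin_neg : IsLocallyFiniteMeasure neg
  mutuallySingular : pos ⟂ₘ neg

/-- The value of a locally finite signed measure on a bounded Borel set. -/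
def LocFinSignedMeasure.value {α : Type*} [TopologicalSpace α] [MeasurableSpace α]
    (ν : LocFinSignedMeasure α) (B : Set α) : ℝ :=
  (ν.pos B).toReal - (ν.neg B).toReal

/-- `c` is (a version of) the density of `ν` with respect to Lebesgue measure. -/
def LocFinSignedMeasure.HasDensity {m d : ℕ} (ν : LocFinSignedMeasure (Fin m → Euc d))
    (c : (Fin m → Euc d) → ℝ) : Prop :=
  LocallyIntegrable c volume ∧
    ∀ B : Set (Fin m → Euc d), MeasurableSet B → Bornology.IsBounded B →
      ν.value B = ∫ y in B, c y

/-- `ν` is the reduced factorial cumulant moment measure of order `m + 1`: for all bounded Borel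
sets `A_1, …, A_{m+1}`,
`γ_[m+1](A_1 × ⋯ × A_{m+1}) = ∫_{A_{m+1}} ν((A_1 - x) × ⋯ × (A_m - x)) dx`. -/
def IsReducedFactorialCumulantMeasure {Ω : Type*} [MeasurableSpace Ω] {d : ℕ} (P : Measure Ω)
    (X : PointProcess Ω d) (m : ℕ) (ν : LocFinSignedMeasure (Fin m → Euc d)) : Prop :=
  ∀ A : Fin (m + 1) → Set (Euc d), (∀ i, MeasurableSet (A i)) →
    (∀ i, Bornology.IsBounded (A i)) →
    factorialCumulant P X (m + 1) A =
      ∫ x in A (Fin.last m),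
        ν.value (Set.univ.pi fun i : Fin m => {y : Euc d | y + x ∈ A i.castSucc})

/-- `(u, v) ↦ 2 C(u) C(v) C(v - u)`. -/
def cyclicDensity3 {d : ℕ} (C : Euc d → ℝ) (y : Fin 2 → Euc d) : ℝ :=
  2 * C (y 0) * C (y 1) * C (y 1 - y 0)

/-- `(u, v, w) ↦ -2 [C(u) C(v) C(u-w) C(v-w) + C(u) C(w) C(u-v) C(v-w)
+ C(v) C(w) C(u-v) C(u-w)]`. -/
def cyclicDensity4 {d : ℕ} (C : Euc d → ℝ) (y : Fin 3 → Euc d) : ℝ :=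
  -2 * (C (y 0) * C (y 1) * C (y 0 - y 2) * C (y 1 - y 2)
    + C (y 0) * C (y 2) * C (y 0 - y 1) * C (y 1 - y 2)
    + C (y 1) * C (y 2) * C (y 0 - y 1) * C (y 0 - y 2))

/-- `K^{⊕ε} = K + B(0, ε)`, for a set `K` of radii. -/
def dilate (K : Set ℝ) (ε : ℝ) : Set ℝ := K + Metric.closedBall (0 : ℝ) ε

end

/-! For a determinantal process each product of factorial moments in the cumulant formula is a
product of integrals of principal minors. The blocks of a partition use disjoint coordinates, so by
Fubini the whole sum is the integral over $A_1\times\dots\times A_k$ of one function of the matrix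
$M=(C(x_i-x_j))$, `detCumulant`. Expanding determinants over permutations, the signed sum over
partitions removes every permutation with more than one cycle and leaves the $k$-cycles. For $k=3$
these are two even cycles, equal by symmetry of $M$; for $k=4$ they are six odd cycles, equal in
inverse pairs. This explains the factors $2$ and $-2$; the code verifies both identities by listing
the partitions and expanding.

The result depends only on differences with the last point, so a measure-preserving shear turns it
into the integral defining the reduced measure; this gives existence. For uniqueness, two densities
with the same integrals over all bounded boxes agree almost everywhere (π-λ argument, then Fubini in
the last point).

The bounds are uniform in $(u,v)$. Nonnegativity of the second intensity gives $|C|\le|C(0)|$, which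
bounds the third density. In each cyclic product of the fourth, two factors are bounded this way and
the other two are translates of $C$ in $w$, whose product is integrable because $C\in L^2$. -/

/-! ### Sums over the partitions of `Fin k` -/

/-- The partition of `Fin k` into the fibres of `m`. -/
def fiberBlocks {k : ℕ} (m : Fin k → Fin k) : Finset (Finset (Fin k)) :=
  Finset.univ.image fun i => Finset.univ.filter fun j => m j = m i

/-- The parts of the partitions of `Fin k`, enumerated through the maps that send each element to
the least element of its block. -/
def partitionBlocks (k : ℕ) : Finset (Finset (Finset (Fin k))) :=
  (Finset.univ.filter fun m : Fin k → Fin k => ∀ i, m i ≤ i ∧ m (m i) = m i).image fiberBlocks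

theorem Finpartition.parts_eq_image_part {k : ℕ} (π : Finpartition (Finset.univ : Finset (Fin k))) :
    π.parts = Finset.univ.image π.part := by
  ext b
  simp only [Finset.mem_image, Finset.mem_univ, true_and]
  constructor
  · intro hb
    obtain ⟨i, hi⟩ := π.nonempty_of_mem_parts hb
    exact ⟨i, π.part_eq_of_mem hb hi⟩
  · rintro ⟨i, rfl⟩
    exact π.part_mem.2 (Finset.mem_univ i)

/-- A partition is recovered from the map sending each element to the least element of its block,
and the fibres of any map form a partition. The right-hand side is an explicit finite filter that
kernel evaluation can enumerate. -/
theorem image_parts_eq_partitionBlocks (k : ℕ) :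
    (Finset.univ : Finset (Finpartition (Finset.univ : Finset (Fin k)))).image
      Finpartition.parts = partitionBlocks k := by
  ext S
  simp only [partitionBlocks, Finset.mem_image, Finset.mem_filter, Finset.mem_univ, true_and]
  constructor
  · rintro ⟨π, rfl⟩
    have hne : ∀ i, (π.part i).Nonempty := fun i => π.part_nonempty.2 (Finset.mem_univ i)
    have hmem : ∀ i, i ∈ π.part i := fun i => π.mem_part (Finset.mem_univ i)
    have hpart : ∀ i, π.part ((π.part i).min' (hne i)) = π.part i := fun i =>
      π.part_eq_of_mem (π.part_mem.2 (Finset.mem_univ i)) (Finset.min'_mem _ _)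
    refine ⟨fun i => (π.part i).min' (hne i), fun i => ⟨Finset.min'_le _ _ (hmem i), ?_⟩, ?_⟩
    · simp only [hpart]
    · rw [π.parts_eq_image_part, fiberBlocks]
      refine Finset.image_congr fun i _ => ?_
      ext j
      simp only [Finset.mem_filter, Finset.mem_univ, true_and]
      rw [π.mem_part_iff_part_eq_part (Finset.mem_univ j) (Finset.mem_univ i)]
      constructor
      · intro h
        rw [← hpart j, ← hpart i, h]
      · intro h
        simp only [h]
  · rintro ⟨m, -, rfl⟩
    let s : Setoid (Fin k) := Setoid.ker m
    have : DecidableRel s.r := fun i j => inferInstanceAs (Decidable (m i = m j))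
    refine ⟨Finpartition.ofSetoid s, ?_⟩
    rw [Finpartition.parts_eq_image_part, fiberBlocks]
    refine Finset.image_congr fun i _ => ?_
    ext j
    rw [Finpartition.mem_part_ofSetoid_iff_rel]
    simp only [Finset.mem_filter, Finset.mem_univ, true_and]
    exact eq_comm

theorem sum_finpartition_eq_sum_partitionBlocks {k : ℕ} (F : Finset (Finset (Fin k)) → ℝ) :
    ∑ π : Finpartition (Finset.univ : Finset (Fin k)), F π.parts =
      ∑ S ∈ partitionBlocks k, F S := by
  rw [← image_parts_eq_partitionBlocks, Finset.sum_image]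
  intro π _ π' _ h
  exact Finpartition.ext h

/-! ### Cumulants of principal minors -/

/-- The principal minor of `M` on the rows and columns in `b`. -/
def blockDet {k : ℕ} (M : Matrix (Fin k) (Fin k) ℝ) (b : Finset (Fin k)) : ℝ :=
  (M.submatrix (b.orderEmbOfFin rfl) (b.orderEmbOfFin rfl)).det

/-- Permuting rows and columns simultaneously leaves a determinant unchanged, so any enumeration of
the block may replace the increasing one. -/
theorem blockDet_eq_det_submatrix {k n : ℕ} (M : Matrix (Fin k) (Fin k) ℝ) (b : Finset (Fin k))
    (f : Fin n → Fin k) (hf : Function.Injective f) (hb : Finset.univ.image f = b) :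
    blockDet M b = (M.submatrix f f).det := by
  have hmem : ∀ i, f i ∈ b := fun i => by rw [← hb]; simp
  let e₁ : Fin n ≃ b := Equiv.ofBijective (fun i => ⟨f i, hmem i⟩)
    ⟨fun i j h => hf (congrArg Subtype.val h), fun ⟨x, hx⟩ => by
      rw [← hb] at hx
      obtain ⟨i, -, hi⟩ := Finset.mem_image.1 hx
      exact ⟨i, Subtype.ext hi⟩⟩
  let e : Fin n ≃ Fin b.card := e₁.trans (b.orderIsoOfFin rfl).symm.toEquiv
  have he : ∀ i, b.orderEmbOfFin rfl (e i) = f i := fun i => by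
    rw [← Finset.coe_orderIsoOfFin_apply]
    exact congrArg Subtype.val ((b.orderIsoOfFin rfl).apply_symm_apply (e₁ i))
  rw [blockDet, ← Matrix.det_submatrix_equiv_self e, Matrix.submatrix_submatrix]
  congr 2 <;> exact funext he

theorem blockDet_singleton {k : ℕ} (M : Matrix (Fin k) (Fin k) ℝ) (i : Fin k) :
    blockDet M {i} = M i i := by
  rw [blockDet_eq_det_submatrix M _ ![i] (Function.injective_of_subsingleton _) (by simp),
    Matrix.det_fin_one]
  rfl

theorem blockDet_pair {k : ℕ} (M : Matrix (Fin k) (Fin k) ℝ) {i j : Fin k} (h : i ≠ j) :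
    blockDet M {i, j} = M i i * M j j - M i j * M j i := by
  rw [blockDet_eq_det_submatrix M _ ![i, j] _ _, Matrix.det_fin_two]
  · simp
  · intro a b hab
    fin_cases a <;> fin_cases b <;> simp_all
  · ext x
    simp [Fin.exists_fin_two, eq_comm]

theorem blockDet_triple {k : ℕ} (M : Matrix (Fin k) (Fin k) ℝ) {i j l : Fin k} (hij : i ≠ j)
    (hil : i ≠ l) (hjl : j ≠ l) :
    blockDet M {i, j, l} = M i i * M j j * M l l - M i i * M j l * M l j - M i j * M j i * M l l
      + M i j * M j l * M l i + M i l * M j i * M l j - M i l * M j j * M l i := by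
  rw [blockDet_eq_det_submatrix M _ ![i, j, l] _ _, Matrix.det_fin_three]
  · simp
  · intro a b hab
    fin_cases a <;> fin_cases b <;> simp_all
  · ext x
    simp [Fin.exists_fin_succ, eq_comm]

theorem blockDet_univ {k : ℕ} (M : Matrix (Fin k) (Fin k) ℝ) :
    blockDet M Finset.univ = M.det := by
  rw [blockDet_eq_det_submatrix M _ id Function.injective_id (by simp)]
  rfl

/-- The combination of products of principal minors of `M` that defines the factorial cumulant. -/
def detCumulant {k : ℕ} (M : Matrix (Fin k) (Fin k) ℝ) : ℝ :=
  ∑ j ∈ Finset.Icc 1 k, (-1 : ℝ) ^ (j - 1) * ((j - 1).factorial : ℝ) *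
    ∑ π : Finpartition (Finset.univ : Finset (Fin k)) with π.parts.card = j,
      ∏ b ∈ π.parts, blockDet M b

/-- Grouping by the number of blocks is undone, since that number always lies between $1$ and $k$.
This fails for $k=0$, where the empty partition has no blocks. -/
theorem detCumulant_eq_sum_partitionBlocks {k : ℕ} (hk : k ≠ 0) (M : Matrix (Fin k) (Fin k) ℝ) :
    detCumulant M = ∑ S ∈ partitionBlocks k,
      (-1 : ℝ) ^ (S.card - 1) * ((S.card - 1).factorial : ℝ) * ∏ b ∈ S, blockDet M b := by
  rw [← sum_finpartition_eq_sum_partitionBlocks fun S =>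
    (-1 : ℝ) ^ (S.card - 1) * ((S.card - 1).factorial : ℝ) * ∏ b ∈ S, blockDet M b]
  have hmaps : ∀ π ∈ (Finset.univ : Finset (Finpartition (Finset.univ : Finset (Fin k)))),
      π.parts.card ∈ Finset.Icc 1 k := by
    intro π _
    refine Finset.mem_Icc.2 ⟨Finset.card_pos.2 ?_, ?_⟩
    · refine π.parts_nonempty ?_
      have : NeZero k := ⟨hk⟩
      exact Finset.univ_nonempty.ne_empty
    · simpa using π.card_parts_le_card
  rw [← Finset.sum_fiberwise_of_maps_to hmaps, detCumulant]
  refine Finset.sum_congr rfl fun j _ => ?_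
  rw [Finset.mul_sum]
  refine Finset.sum_congr rfl fun π hπ => ?_
  rw [(Finset.mem_filter.1 hπ).2]

theorem partitionBlocks_three : partitionBlocks 3 =
    {{{0, 1, 2}}, {{0}, {1, 2}}, {{1}, {0, 2}}, {{2}, {0, 1}}, {{0}, {1}, {2}}} := by
  decide +kernel

theorem partitionBlocks_four : partitionBlocks 4 =
    {{Finset.univ}, {{0}, {1, 2, 3}}, {{1}, {0, 2, 3}}, {{2}, {0, 1, 3}}, {{3}, {0, 1, 2}},
      {{0, 1}, {2, 3}}, {{0, 2}, {1, 3}}, {{0, 3}, {1, 2}},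
      {{0}, {1}, {2, 3}}, {{0}, {2}, {1, 3}}, {{0}, {3}, {1, 2}}, {{1}, {2}, {0, 3}},
      {{1}, {3}, {0, 2}}, {{2}, {3}, {0, 1}}, {{0}, {1}, {2}, {3}}} := by
  decide +kernel

/-- Only the two 3-cycles survive; they are even and coincide by symmetry. -/
theorem detCumulant_three {M : Matrix (Fin 3) (Fin 3) ℝ} (hM : M.IsSymm) :
    detCumulant M = 2 * M 0 2 * M 1 2 * M 0 1 := by
  have h10 : M 1 0 = M 0 1 := hM.apply 0 1
  have h20 : M 2 0 = M 0 2 := hM.apply 0 2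
  have h21 : M 2 1 = M 1 2 := hM.apply 1 2
  rw [detCumulant_eq_sum_partitionBlocks (by decide), partitionBlocks_three]
  repeat rw [Finset.sum_insert (by decide +kernel)]
  rw [Finset.sum_singleton]
  repeat rw [Finset.prod_insert (by decide +kernel)]
  simp (discharger := decide) only [Finset.prod_singleton, blockDet_singleton, blockDet_pair,
    blockDet_triple, Finset.card_insert_of_notMem, Finset.card_singleton, h10, h20, h21]
  norm_num [Nat.factorial]
  ring

/-- Only the six 4-cycles survive; they are odd, and each coincides with its inverse by symmetry. -/
theorem detCumulant_four {M : Matrix (Fin 4) (Fin 4) ℝ} (hM : M.IsSymm) :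
    detCumulant M = -2 * (M 0 3 * M 1 3 * M 0 2 * M 1 2 + M 0 3 * M 2 3 * M 0 1 * M 1 2
      + M 1 3 * M 2 3 * M 0 1 * M 0 2) := by
  have h10 : M 1 0 = M 0 1 := hM.apply 0 1
  have h20 : M 2 0 = M 0 2 := hM.apply 0 2
  have h21 : M 2 1 = M 1 2 := hM.apply 1 2
  have h30 : M 3 0 = M 0 3 := hM.apply 0 3
  have h31 : M 3 1 = M 1 3 := hM.apply 1 3
  have h32 : M 3 2 = M 2 3 := hM.apply 2 3
  -- Laplace expansion along row 0. Only the first minor is principal, so it alone can be written as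
  -- a `blockDet`.
  have hdet : M.det = M 0 0 * blockDet M {1, 2, 3}
      - M 0 1 * (M 1 0 * (M 2 2 * M 3 3 - M 2 3 * M 3 2) - M 1 2 * (M 2 0 * M 3 3 - M 2 3 * M 3 0)
        + M 1 3 * (M 2 0 * M 3 2 - M 2 2 * M 3 0))
      + M 0 2 * (M 1 0 * (M 2 1 * M 3 3 - M 2 3 * M 3 1) - M 1 1 * (M 2 0 * M 3 3 - M 2 3 * M 3 0)
        + M 1 3 * (M 2 0 * M 3 1 - M 2 1 * M 3 0))
      - M 0 3 * (M 1 0 * (M 2 1 * M 3 2 - M 2 2 * M 3 1) - M 1 1 * (M 2 0 * M 3 2 - M 2 2 * M 3 0)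
        + M 1 2 * (M 2 0 * M 3 1 - M 2 1 * M 3 0)) := by
    rw [blockDet_triple M (by decide) (by decide) (by decide), Matrix.det_succ_row_zero]
    simp [Fin.sum_univ_four, Matrix.det_fin_three, Fin.succAbove]
    ring
  rw [detCumulant_eq_sum_partitionBlocks (by decide), partitionBlocks_four]
  repeat rw [Finset.sum_insert (by decide +kernel)]
  rw [Finset.sum_singleton]
  repeat rw [Finset.prod_insert (by decide +kernel)]
  simp (discharger := decide) only [Finset.prod_singleton, blockDet_singleton, blockDet_pair,
    blockDet_triple, blockDet_univ, hdet, Finset.card_insert_of_notMem, Finset.card_singleton,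
    h10, h20, h21, h30, h31, h32]
  norm_num [Nat.factorial]
  ring

/-! ### Factorization of integrals over blocks of coordinates -/

theorem measurePreserving_piCurry_symm {β : Type*} [Fintype β] {κ : β → Type*}
    [∀ b, Fintype (κ b)] {E : (b : β) → κ b → Type*} [∀ b j, MeasurableSpace (E b j)]
    (μ : ∀ b j, Measure (E b j)) [∀ b j, SigmaFinite (μ b j)] :
    MeasurePreserving (MeasurableEquiv.piCurry E).symm
      (Measure.pi fun b => Measure.pi (μ b)) (Measure.pi fun p : (b : β) × κ b => μ p.1 p.2) where
  measurable := (MeasurableEquiv.piCurry E).symm.measurable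
  map_eq := by
    refine (Measure.pi_eq fun s _ => ?_).symm
    have : (MeasurableEquiv.piCurry E).symm ⁻¹' Set.univ.pi s =
        Set.univ.pi fun b => Set.univ.pi fun j => s ⟨b, j⟩ := by
      ext x
      simp only [Set.mem_preimage, Set.mem_univ_pi]
      exact ⟨fun h b j => h ⟨b, j⟩, fun h p => h p.1 p.2⟩
    rw [MeasurableEquiv.map_apply, this, Measure.pi_pi, Fintype.prod_sigma]
    simp only [Measure.pi_pi]

/-- The integral of a product of functions of disjoint blocks of coordinates is the product of
the integrals over the blocks. -/
theorem integral_prod_blocks {ι β E : Type*} [Fintype ι] [Fintype β] {κ : β → Type*}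
    [∀ b, Fintype (κ b)] [MeasurableSpace E] (μ : ι → Measure E) [∀ i, SigmaFinite (μ i)]
    (e : ((b : β) × κ b) ≃ ι) (f : (b : β) → (κ b → E) → ℝ) :
    ∫ x, ∏ b, f b (fun j => x (e ⟨b, j⟩)) ∂Measure.pi μ =
      ∏ b, ∫ y, f b y ∂Measure.pi fun j => μ (e ⟨b, j⟩) := by
  rw [← integral_fintype_prod_eq_prod,
    ← (measurePreserving_piCongrLeft (α := fun _ => E) μ e).integral_comp',
    ← (measurePreserving_piCurry_symm fun b j => μ (e ⟨b, j⟩)).integral_comp']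
  refine integral_congr_ae (Filter.Eventually.of_forall fun x => ?_)
  refine Finset.prod_congr rfl fun b _ => congrArg _ (funext fun j => ?_)
  rw [MeasurableEquiv.coe_piCongrLeft, Equiv.piCongrLeft_apply_apply]
  rfl

/-- The elements of `Fin k`, indexed by the block of `π` that contains them and their rank in it. -/
noncomputable def Finpartition.sigmaEquiv {k : ℕ} (π : Finpartition (Finset.univ : Finset (Fin k))) :
    ((b : π.parts) × Fin b.1.card) ≃ Fin k :=
  Equiv.ofBijective (fun p => p.1.1.orderEmbOfFin rfl p.2) (by
    constructor
    · rintro ⟨⟨b, hb⟩, i⟩ ⟨⟨b', hb'⟩, i'⟩ h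
      have h₁ := b.orderEmbOfFin_mem rfl i
      have h₂ := b'.orderEmbOfFin_mem rfl i'
      dsimp only at h
      rw [← h] at h₂
      obtain rfl : b = b' := π.eq_of_mem_parts hb hb' h₁ h₂
      obtain rfl := (b.orderEmbOfFin rfl).injective h
      rfl
    · intro x
      obtain ⟨i, hi⟩ : x ∈ Set.range ((π.part x).orderEmbOfFin rfl) := by
        rw [Finset.range_orderEmbOfFin]
        exact π.mem_part (Finset.mem_univ x)
      exact ⟨⟨⟨π.part x, π.part_mem.2 (Finset.mem_univ x)⟩, i⟩, hi⟩)

/-! ### Factorial cumulants of a determinantal point process -/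

/-- The matrix `(C (x i - x j))_{i, j}`. -/
def kernelMatrix {d k : ℕ} (C : Euc d → ℝ) (x : Fin k → Euc d) : Matrix (Fin k) (Fin k) ℝ :=
  Matrix.of fun i j => C (x i - x j)

theorem continuous_det_kernelMatrix {d k : ℕ} {C : Euc d → ℝ} (hC : Continuous C) :
    Continuous fun x : Fin k → Euc d => (kernelMatrix C x).det := by
  refine Continuous.matrix_det (continuous_matrix fun i j => ?_)
  exact hC.comp ((continuous_apply i).sub (continuous_apply j))

theorem integrableOn_pi_of_continuous {d k : ℕ} {f : (Fin k → Euc d) → ℝ} (hf : Continuous f)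
    {B : Set (Fin k → Euc d)} (hB : Bornology.IsBounded B) : IntegrableOn f B :=
  (hf.continuousOn.integrableOn_compact hB.isCompact_closure).mono_set subset_closure

theorem factorialMoment_toReal_eq_setIntegral {Ω : Type*} [MeasurableSpace Ω] {P : Measure Ω}
    {d : ℕ} {X : PointProcess Ω d} {C : Euc d → ℝ} (hX : IsDPP P X C) {k : ℕ} (hk : 1 ≤ k)
    {D : Set (Fin k → Euc d)} (hD : MeasurableSet D) :
    (factorialMoment P X k D).toReal = ∫ x in D, (kernelMatrix C x).det := by
  obtain ⟨hm, hnn, hint⟩ := hX k hk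
  rw [hint D hD]
  exact (integral_eq_lintegral_of_nonneg_ae (ae_restrict_of_ae hnn)
    hm.aestronglyMeasurable.restrict).symm

/-- Blocks involve disjoint coordinates, so a product of block integrals is one integral over the
full box. Linearity then moves the sum inside; continuity on a bounded box supplies integrability.
-/
theorem factorialCumulant_eq_setIntegral_detCumulant {Ω : Type*} [MeasurableSpace Ω]
    {P : Measure Ω} {d : ℕ} {X : PointProcess Ω d} {C : Euc d → ℝ} (hC : Continuous C)
    (hX : IsDPP P X C) {k : ℕ} {A : Fin k → Set (Euc d)} (hA : ∀ i, MeasurableSet (A i))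
    (hA' : ∀ i, Bornology.IsBounded (A i)) :
    factorialCumulant P X k A = ∫ x in Set.univ.pi A, detCumulant (kernelMatrix C x) := by
  have hcont : ∀ b : Finset (Fin k), Continuous fun x : Fin k → Euc d =>
      blockDet (kernelMatrix C x) b := fun b =>
    (continuous_det_kernelMatrix (k := b.card) hC).comp
      (continuous_pi fun i => continuous_apply (b.orderEmbOfFin rfl i))
  have hint : ∀ f : (Fin k → Euc d) → ℝ, Continuous f → IntegrableOn f (Set.univ.pi A) :=
    fun f hf => integrableOn_pi_of_continuous hf (Bornology.IsBounded.pi hA')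
  unfold factorialCumulant detCumulant
  rw [integral_finsetSum _ fun j _ => hint _ (by fun_prop)]
  refine Finset.sum_congr rfl fun j _ => ?_
  rw [integral_const_mul, integral_finsetSum _ fun π _ => hint _ (by fun_prop)]
  congr 1
  refine Finset.sum_congr rfl fun π _ => ?_
  have hblock : ∀ b ∈ π.parts, (factorialMoment P X b.card
      (Set.univ.pi fun i : Fin b.card => A (b.orderEmbOfFin rfl i))).toReal =
      ∫ y, (kernelMatrix C y).det
        ∂Measure.pi fun i => (volume : Measure (Euc d)).restrict (A (b.orderEmbOfFin rfl i)) := by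
    intro b hb
    rw [factorialMoment_toReal_eq_setIntegral hX (Finset.card_pos.2 (π.nonempty_of_mem_parts hb))
      (MeasurableSet.univ_pi fun i => hA _), volume_pi, Measure.restrict_pi_pi]
  rw [Finset.prod_congr rfl hblock, ← Finset.prod_coe_sort, volume_pi, Measure.restrict_pi_pi]
  refine (integral_prod_blocks (fun i => (volume : Measure (Euc d)).restrict (A i)) π.sigmaEquiv
    (fun b y => (kernelMatrix C y).det)).symm.trans ?_
  refine integral_congr_ae (Filter.Eventually.of_forall fun x => ?_)
  exact Finset.prod_coe_sort π.parts fun b => blockDet (kernelMatrix C x) b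

theorem kernelMatrix_isSymm {d k : ℕ} {C : Euc d → ℝ} (hC : ∀ x, C (-x) = C x)
    (x : Fin k → Euc d) : (kernelMatrix C x).IsSymm := by
  ext i j
  simp only [Matrix.transpose_apply, kernelMatrix, Matrix.of_apply]
  rw [← neg_sub, hC]

/-- The positions of the first `m` points relative to the last one. -/
def relativePositions {m : ℕ} {E : Type*} [AddCommGroup E] (x : Fin (m + 1) → E) : Fin m → E :=
  fun i => x i.castSucc - x (Fin.last m)

theorem detCumulant_kernelMatrix_three {d : ℕ} {C : Euc d → ℝ} (hC : ∀ x, C (-x) = C x)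
    (x : Fin 3 → Euc d) :
    detCumulant (kernelMatrix C x) = cyclicDensity3 C (relativePositions x) := by
  rw [detCumulant_three (kernelMatrix_isSymm hC x)]
  have h : C (x 0 - x 1) = C (x 1 - x 0) := by rw [← hC, neg_sub]
  simp [cyclicDensity3, relativePositions, kernelMatrix, h]

theorem detCumulant_kernelMatrix_four {d : ℕ} {C : Euc d → ℝ} (hC : ∀ x, C (-x) = C x)
    (x : Fin 4 → Euc d) :
    detCumulant (kernelMatrix C x) = cyclicDensity4 C (relativePositions x) := by
  rw [detCumulant_four (kernelMatrix_isSymm hC x)]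
  simp [cyclicDensity4, relativePositions, kernelMatrix]

/-! ### Passing to relative positions -/

/-- The measurable equivalence `(a, y) ↦ (a, y - a)`. -/
def shearEquiv (m d : ℕ) : Euc d × (Fin m → Euc d) ≃ᵐ Euc d × (Fin m → Euc d) where
  toFun p := (p.1, fun i => p.2 i - p.1)
  invFun p := (p.1, fun i => p.2 i + p.1)
  left_inv p := by simp
  right_inv p := by simp
  measurable_toFun := by
    change Measurable fun p : Euc d × (Fin m → Euc d) => (p.1, fun i => p.2 i - p.1)
    fun_prop
  measurable_invFun := by
    change Measurable fun p : Euc d × (Fin m → Euc d) => (p.1, fun i => p.2 i + p.1)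
    fun_prop

theorem measurePreserving_shearEquiv (m d : ℕ) : MeasurePreserving (shearEquiv m d) := by
  refine MeasurePreserving.skew_product (g := fun a (y : Fin m → Euc d) i => y i - a)
    (MeasurePreserving.id volume) (by unfold Function.uncurry; fun_prop)
    (Filter.Eventually.of_forall fun a => ?_)
  exact (measurePreserving_sub_right volume (fun _ : Fin m => a)).map_eq

/-- The configuration `x` in terms of its last point and the relative positions of the others. -/
def relativeEquiv (m d : ℕ) : (Fin (m + 1) → Euc d) ≃ᵐ Euc d × (Fin m → Euc d) :=
  (MeasurableEquiv.piFinSuccAbove (fun _ => Euc d) (Fin.last m)).trans (shearEquiv m d)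

theorem measurePreserving_relativeEquiv (m d : ℕ) : MeasurePreserving (relativeEquiv m d) :=
  (measurePreserving_shearEquiv m d).comp
    (volume_preserving_piFinSuccAbove (fun _ => Euc d) (Fin.last m))

theorem relativeEquiv_apply {m d : ℕ} (x : Fin (m + 1) → Euc d) :
    relativeEquiv m d x = (x (Fin.last m), relativePositions x) := by
  ext1
  · rfl
  · funext i
    change x ((Fin.last m).succAbove i) - x (Fin.last m) = _
    rw [Fin.succAbove_last]
    rfl

/-- A bounded box of configurations is sent by `relativeEquiv` into a product of two balls, on which
a function of the second coordinate alone is integrable. -/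
theorem integrableOn_comp_relativePositions {m d : ℕ} {h : (Fin m → Euc d) → ℝ}
    (hh : LocallyIntegrable h) {A : Fin (m + 1) → Set (Euc d)}
    (hA : ∀ i, Bornology.IsBounded (A i)) :
    IntegrableOn (fun x => h (relativePositions x)) (Set.univ.pi A) := by
  obtain ⟨r, hr⟩ := (Bornology.IsBounded.pi hA).subset_closedBall 0
  -- If all points have norm at most $r$, their differences have norm at most $r+r$.
  have hsub : Set.univ.pi A ⊆ relativeEquiv m d ⁻¹'
      (Metric.closedBall 0 r ×ˢ Metric.closedBall 0 (r + r)) := by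
    intro x hx
    have hx' : ‖x‖ ≤ r := by simpa using hr hx
    have hr0 : 0 ≤ r := (norm_nonneg _).trans hx'
    rw [Set.mem_preimage, relativeEquiv_apply]
    refine ⟨by simpa using (norm_le_pi_norm x _).trans hx', ?_⟩
    rw [mem_closedBall_zero_iff, pi_norm_le_iff_of_nonneg (by positivity)]
    intro i
    exact (norm_sub_le _ _).trans (add_le_add ((norm_le_pi_norm x _).trans hx')
      ((norm_le_pi_norm x _).trans hx'))
  refine IntegrableOn.mono_set ?_ hsub
  have hprod : IntegrableOn (fun p : Euc d × (Fin m → Euc d) => h p.2)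
      (Metric.closedBall 0 r ×ˢ Metric.closedBall 0 (r + r)) := by
    rw [IntegrableOn, Measure.volume_eq_prod, ← Measure.prod_restrict]
    have : IsFiniteMeasure ((volume : Measure (Euc d)).restrict (Metric.closedBall 0 r)) :=
      ⟨by simpa using measure_closedBall_lt_top⟩
    exact Integrable.comp_snd (hh.integrableOn_isCompact (isCompact_closedBall _ _)) _
  have := ((measurePreserving_relativeEquiv m d).integrableOn_comp_preimage
    (relativeEquiv m d).measurableEmbedding).2 hprod
  refine this.congr_fun_ae (Filter.Eventually.of_forall fun x => ?_)
  simp only [Function.comp_apply, relativeEquiv_apply]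

/-- Fubini after the change of variables `relativeEquiv`: the image of the box has, over a last
point $x$, the section $\prod_i (A_i-x)$. -/
theorem setIntegral_pi_comp_relativePositions {m d : ℕ} {h : (Fin m → Euc d) → ℝ}
    (hh : LocallyIntegrable h) {A : Fin (m + 1) → Set (Euc d)} (hA : ∀ i, MeasurableSet (A i))
    (hA' : ∀ i, Bornology.IsBounded (A i)) :
    ∫ x in Set.univ.pi A, h (relativePositions x) =
      ∫ x in A (Fin.last m),
        ∫ y in Set.univ.pi fun i : Fin m => {y : Euc d | y + x ∈ A i.castSucc}, h y := by
  classical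
  set e := relativeEquiv m d
  have hsec : ∀ x : Euc d, MeasurableSet
      (Set.univ.pi fun i : Fin m => {y : Euc d | y + x ∈ A i.castSucc}) := fun x =>
    MeasurableSet.univ_pi fun i => (measurable_id.add_const x) (hA _)
  let T : Set (Euc d × (Fin m → Euc d)) := e.symm ⁻¹' Set.univ.pi A
  have hT : MeasurableSet T := e.symm.measurable (MeasurableSet.univ_pi hA)
  have hpre : e ⁻¹' T = Set.univ.pi A := by
    ext x
    simp [T]
  have hmemT : ∀ x y, (x, y) ∈ T ↔ x ∈ A (Fin.last m) ∧
      y ∈ Set.univ.pi fun i : Fin m => {y : Euc d | y + x ∈ A i.castSucc} := by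
    intro x y
    obtain ⟨z, hz⟩ := e.surjective (x, y)
    have hz' := hz
    rw [relativeEquiv_apply] at hz'
    obtain ⟨rfl, rfl⟩ := Prod.mk.inj hz'
    rw [← hz, ← Set.mem_preimage, hpre, Set.mem_univ_pi, Fin.forall_fin_succ']
    simp [relativePositions, and_comm]
  have hmp := measurePreserving_relativeEquiv m d
  have hint : IntegrableOn (fun p : Euc d × (Fin m → Euc d) => h p.2) T := by
    rw [← hmp.integrableOn_comp_preimage e.measurableEmbedding, hpre]
    refine (integrableOn_comp_relativePositions hh hA').congr_fun_ae
      (Filter.Eventually.of_forall fun x => ?_)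
    simp only [Function.comp_apply, relativeEquiv_apply]
  have hcov := hmp.setIntegral_preimage_emb e.measurableEmbedding (fun p => h p.2) T
  rw [hpre] at hcov
  simp only [relativeEquiv_apply] at hcov
  rw [hcov, ← integral_indicator hT, Measure.volume_eq_prod,
    integral_prod _ ((integrable_indicator_iff hT).2 hint), ← integral_indicator (hA _)]
  refine integral_congr_ae (Filter.Eventually.of_forall fun x => ?_)
  by_cases hx : x ∈ A (Fin.last m)
  · dsimp only
    rw [Set.indicator_of_mem hx, ← integral_indicator (hsec x)]
    refine integral_congr_ae (Filter.Eventually.of_forall fun y => ?_)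
    simp only [Set.indicator_apply, hmemT, hx, true_and]
  · dsimp only
    rw [Set.indicator_of_notMem hx]
    simp [hmemT, hx]

/-- On each product of balls `Q n`, the sets over which `H` integrates to zero form a Dynkin system
containing the measurable boxes, hence all measurable sets. The `Q n` exhaust the space. -/
theorem ae_eq_zero_of_setIntegral_pi_eq_zero {k d : ℕ} {H : (Fin k → Euc d) → ℝ}
    (hint : ∀ A : Fin k → Set (Euc d), (∀ i, Bornology.IsBounded (A i)) →
      IntegrableOn H (Set.univ.pi A))
    (hzero : ∀ A : Fin k → Set (Euc d), (∀ i, MeasurableSet (A i)) →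
      (∀ i, Bornology.IsBounded (A i)) → ∫ x in Set.univ.pi A, H x = 0) :
    H =ᵐ[volume] 0 := by
  let Q : ℕ → Set (Fin k → Euc d) := fun n => Set.univ.pi fun _ => Metric.ball 0 n
  have hQ : ⋃ n, Q n = Set.univ := by
    refine Set.eq_univ_of_forall fun x => Set.mem_iUnion.2 ?_
    obtain ⟨n, hn⟩ := exists_nat_gt ‖x‖
    exact ⟨n, fun i _ => mem_ball_zero_iff.2 ((norm_le_pi_norm x i).trans_lt hn)⟩
  have hloc : ∀ n, H =ᵐ[volume.restrict (Q n)] 0 := by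
    intro n
    have hI : Integrable H (volume.restrict (Q n)) := hint _ fun _ => Metric.isBounded_ball
    have huniv : ∫ x, H x ∂volume.restrict (Q n) = 0 :=
      hzero _ (fun _ => measurableSet_ball) fun _ => Metric.isBounded_ball
    suffices hs : ∀ s, MeasurableSet s → ∫ x in s, H x ∂volume.restrict (Q n) = 0 from
      hI.ae_eq_zero_of_forall_setIntegral_eq_zero fun s h _ => hs s h
    intro s hs
    refine MeasurableSpace.induction_on_inter
      (C := fun s _ => ∫ x in s, H x ∂volume.restrict (Q n) = 0) generateFrom_pi.symm
      isPiSystem_pi ?_ ?_ ?_ ?_ s hs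
    · simp
    · rintro _ ⟨A, hA, rfl⟩
      have hA' : ∀ i, MeasurableSet (A i) := fun i => hA i (Set.mem_univ i)
      rw [Measure.restrict_restrict (MeasurableSet.univ_pi hA'), ← Set.pi_inter_distrib]
      exact hzero _ (fun i => (hA' i).inter measurableSet_ball)
        fun i => Metric.isBounded_ball.subset Set.inter_subset_right
    -- Closure under complements uses that the integral over all of `Q n` vanishes.
    · intro t ht ih
      have := integral_add_compl ht hI
      rw [ih, huniv, zero_add] at this
      exact this
    · intro f hd hf ih
      rw [integral_iUnion hf hd hI.integrableOn]
      simp [ih]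
  have := (ae_restrict_iUnion_iff Q fun x => H x = 0).2 hloc
  rwa [hQ, Measure.restrict_univ] at this

theorem ae_eq_of_setIntegral_relativePositions_eq {m d : ℕ} {c c' : (Fin m → Euc d) → ℝ}
    (hc : LocallyIntegrable c) (hc' : LocallyIntegrable c')
    (h : ∀ A : Fin (m + 1) → Set (Euc d), (∀ i, MeasurableSet (A i)) →
      (∀ i, Bornology.IsBounded (A i)) →
      ∫ x in Set.univ.pi A, c (relativePositions x) =
        ∫ x in Set.univ.pi A, c' (relativePositions x)) :
    c =ᵐ[volume] c' := by
  have hzero : (fun x : Fin (m + 1) → Euc d => c (relativePositions x) - c' (relativePositions x))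
      =ᵐ[volume] 0 := by
    refine ae_eq_zero_of_setIntegral_pi_eq_zero (fun A hA => ?_) fun A hA hA' => ?_
    · exact (integrableOn_comp_relativePositions hc hA).sub
        (integrableOn_comp_relativePositions hc' hA)
    · rw [integral_sub (integrableOn_comp_relativePositions hc hA')
        (integrableOn_comp_relativePositions hc' hA'), h A hA hA', sub_self]
  have hmp := (measurePreserving_relativeEquiv m d).symm
  have hprod : ∀ᵐ p : Euc d × (Fin m → Euc d), c p.2 = c' p.2 := by
    filter_upwards [hmp.quasiMeasurePreserving.ae hzero] with p hp
    have hrel : relativePositions ((relativeEquiv m d).symm p) = p.2 := by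
      have := relativeEquiv_apply ((relativeEquiv m d).symm p)
      rw [MeasurableEquiv.apply_symm_apply] at this
      exact (congrArg Prod.snd this).symm
    simpa only [hrel, Pi.zero_apply, sub_eq_zero] using hp
  -- The equality does not involve the last point, so one value of it that is good for almost every
  -- `y` suffices.
  exact (Measure.ae_ae_of_ae_prod hprod).exists.choose_spec

/-! ### Existence and uniqueness of the reduced cumulant measures -/

/-- The signed measure with density `c` with respect to Lebesgue measure. -/
noncomputable def signedMeasureOfDensity {m d : ℕ} (c : (Fin m → Euc d) → ℝ) (hc : Continuous c) :
    LocFinSignedMeasure (Fin m → Euc d) where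
  pos := volume.withDensity fun y => ENNReal.ofReal (c y)
  neg := volume.withDensity fun y => ENNReal.ofReal (-c y)
  locFin_pos := IsLocallyFiniteMeasure.withDensity_ofReal hc
  locFin_neg := IsLocallyFiniteMeasure.withDensity_ofReal hc.neg
  mutuallySingular := withDensity_ofReal_mutuallySingular hc.measurable

theorem hasDensity_signedMeasureOfDensity {m d : ℕ} {c : (Fin m → Euc d) → ℝ}
    (hc : Continuous c) : (signedMeasureOfDensity c hc).HasDensity c := by
  refine ⟨hc.locallyIntegrable, fun B hB hB' => ?_⟩
  rw [integral_eq_lintegral_pos_part_sub_lintegral_neg_part (integrableOn_pi_of_continuous hc hB')]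
  simp only [LocFinSignedMeasure.value, signedMeasureOfDensity, withDensity_apply _ hB]

theorem LocFinSignedMeasure.HasDensity.setIntegral_value {m d : ℕ}
    {ν : LocFinSignedMeasure (Fin m → Euc d)} {c : (Fin m → Euc d) → ℝ} (hν : ν.HasDensity c)
    {A : Fin (m + 1) → Set (Euc d)} (hA : ∀ i, MeasurableSet (A i))
    (hA' : ∀ i, Bornology.IsBounded (A i)) :
    ∫ x in A (Fin.last m),
        ν.value (Set.univ.pi fun i : Fin m => {y : Euc d | y + x ∈ A i.castSucc}) =
      ∫ x in Set.univ.pi A, c (relativePositions x) := by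
  rw [setIntegral_pi_comp_relativePositions hν.1 hA hA']
  refine integral_congr_ae (Filter.Eventually.of_forall fun x => hν.2 _ ?_ ?_)
  · exact MeasurableSet.univ_pi fun i => (measurable_id.add_const x) (hA _)
  · refine Bornology.IsBounded.pi fun i => ?_
    refine ((hA' i.castSucc).sub (Bornology.isBounded_singleton (x := x))).subset fun y hy => ?_
    exact ⟨y + x, hy, x, rfl, add_sub_cancel_right y x⟩

theorem isReducedFactorialCumulantMeasure_of_hasDensity {Ω : Type*} [MeasurableSpace Ω]
    {P : Measure Ω} {d m : ℕ} {X : PointProcess Ω d} {C : Euc d → ℝ} (hC : Continuous C)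
    (hX : IsDPP P X C) {c : (Fin m → Euc d) → ℝ}
    (hcum : ∀ x : Fin (m + 1) → Euc d, detCumulant (kernelMatrix C x) = c (relativePositions x))
    {ν : LocFinSignedMeasure (Fin m → Euc d)} (hν : ν.HasDensity c) :
    IsReducedFactorialCumulantMeasure P X m ν := by
  intro A hA hA'
  rw [hν.setIntegral_value hA hA', factorialCumulant_eq_setIntegral_detCumulant hC hX hA hA']
  simp only [hcum]

/-- Pulled back to configurations, both densities integrate over every bounded box to the same
factorial cumulant. -/
theorem density_ae_eq_of_isReducedFactorialCumulantMeasure {Ω : Type*} [MeasurableSpace Ω]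
    {P : Measure Ω} {d m : ℕ} {X : PointProcess Ω d} {C : Euc d → ℝ} (hC : Continuous C)
    (hX : IsDPP P X C) {c c' : (Fin m → Euc d) → ℝ} (hc : Continuous c)
    (hcum : ∀ x : Fin (m + 1) → Euc d, detCumulant (kernelMatrix C x) = c (relativePositions x))
    {ν : LocFinSignedMeasure (Fin m → Euc d)} (hred : IsReducedFactorialCumulantMeasure P X m ν)
    (hν : ν.HasDensity c') : c' =ᵐ[volume] c := by
  refine ae_eq_of_setIntegral_relativePositions_eq hν.1 hc.locallyIntegrable fun A hA hA' => ?_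
  rw [← hν.setIntegral_value hA hA', ← hred A hA hA',
    factorialCumulant_eq_setIntegral_detCumulant hC hX hA hA']
  simp only [hcum]

theorem continuous_cyclicDensity3 {d : ℕ} {C : Euc d → ℝ} (hC : Continuous C) :
    Continuous (cyclicDensity3 C) := by
  unfold cyclicDensity3
  fun_prop

theorem continuous_cyclicDensity4 {d : ℕ} {C : Euc d → ℝ} (hC : Continuous C) :
    Continuous (cyclicDensity4 C) := by
  unfold cyclicDensity4
  fun_prop

/-! ### Bounds on the densities -/

/-- The kernel of a determinantal point process is bounded by its value at the origin. -/
theorem abs_le_of_isDPP {Ω : Type*} [MeasurableSpace Ω] {P : Measure Ω} {d : ℕ}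
    {X : PointProcess Ω d} {C : Euc d → ℝ} (hC : Continuous C) (hsymm : ∀ x, C (-x) = C x)
    (hX : IsDPP P X C) (x : Euc d) : |C x| ≤ |C 0| := by
  -- The second intensity is nonnegative almost everywhere, hence on a dense set, and by continuity
  -- everywhere.
  have hnn : ∀ y : Fin 2 → Euc d, 0 ≤ (kernelMatrix C y).det := by
    have hclosed : IsClosed {y : Fin 2 → Euc d | 0 ≤ (kernelMatrix C y).det} :=
      isClosed_le continuous_const (continuous_det_kernelMatrix hC)
    have hdense : Dense {y : Fin 2 → Euc d | 0 ≤ (kernelMatrix C y).det} :=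
      Measure.dense_of_ae (hX 2 one_le_two).2.1
    intro y
    have := hdense y
    rwa [hclosed.closure_eq] at this
  -- At the pair $(x,0)$ the determinant is $C(0)^2-C(x)^2$.
  have h := hnn ![x, 0]
  rw [Matrix.det_fin_two] at h
  simp only [kernelMatrix, Matrix.of_apply, sub_self, Matrix.cons_val_zero, Matrix.cons_val_one,
    sub_zero, zero_sub, hsymm] at h
  exact sq_le_sq.1 (by linarith)

theorem abs_cyclicDensity3_le {d : ℕ} {C : Euc d → ℝ} {r : ℝ} (hr : ∀ x, |C x| ≤ r)
    (y : Fin 2 → Euc d) : |cyclicDensity3 C y| ≤ 2 * r * r * r := by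
  have h0 : 0 ≤ r := (abs_nonneg _).trans (hr 0)
  simp only [cyclicDensity3, abs_mul, abs_two]
  gcongr <;> exact hr _

/-- In each of the three products, two factors are bounded by $r$ and the other two, both depending
on $w$, are split by $|xy|\le(x^2+y^2)/2$. Two products contain a pair of factors free of $w$; in
the third all four depend on $w$ and two are sacrificed. -/
theorem abs_cyclicDensity4_le {d : ℕ} {C : Euc d → ℝ} (hsymm : ∀ x, C (-x) = C x) {r : ℝ}
    (hr : ∀ x, |C x| ≤ r)
    (u v w : Euc d) :
    |cyclicDensity4 C ![u, w, v + w]| ≤ 2 * (r * r) *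
      (C w ^ 2 + C (w + (v - u)) ^ 2 + C (w + v) ^ 2 + C (w + -u) ^ 2) := by
  have key : ∀ a b x y : ℝ, |a| ≤ r → |b| ≤ r → |a * b * (x * y)| ≤ r * r * ((x ^ 2 + y ^ 2) / 2) := by
    intro a b x y ha hb
    rw [abs_mul, abs_mul]
    have hxy : |x * y| ≤ (x ^ 2 + y ^ 2) / 2 := by
      rw [abs_le]
      constructor <;> nlinarith [sq_nonneg (x + y), sq_nonneg (x - y)]
    have := (abs_nonneg a).trans ha
    gcongr
  have h₁ : C (u - (v + w)) = C (w + (v - u)) := by rw [← hsymm]; congr 1; abel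
  have h₂ : C (u - w) = C (w + -u) := by rw [← hsymm]; congr 1; abel
  have h₃ : C (v + w) = C (w + v) := by rw [add_comm]
  have e : cyclicDensity4 C ![u, w, v + w] =
      -(2 * (C u * C (w - (v + w)) * (C w * C (w + (v - u)))
        + C u * C (w - (v + w)) * (C (w + v) * C (w + -u))
        + C w * C (w + (v - u)) * (C (w + v) * C (w + -u)))) := by
    simp [cyclicDensity4, h₁, h₂, h₃]
    ring
  rw [e, abs_neg, abs_mul, abs_two, mul_assoc 2 (r * r)]
  refine mul_le_mul_of_nonneg_left ((abs_add_three _ _ _).trans ?_) zero_le_two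
  have t₁ := key _ _ (C w) (C (w + (v - u))) (hr u) (hr (w - (v + w)))
  have t₂ := key _ _ (C (w + v)) (C (w + -u)) (hr u) (hr (w - (v + w)))
  have t₃ := key _ _ (C (w + v)) (C (w + -u)) (hr w) (hr (w + (v - u)))
  -- The first pair of squares occurs in one of the three bounds and the second pair in two; this
  -- fills the gap to the symmetric sum.
  have hrest : 0 ≤ r * r * ((C w ^ 2 + C (w + (v - u)) ^ 2) / 2) :=
    mul_nonneg (mul_self_nonneg r) (by positivity)
  linarith

/-- Each of the four squares is a translate of $C^2$ in $w$, so the bound does not depend on $u$ and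
$v$. -/
theorem lintegral_cyclicDensity4_le {d : ℕ} {C : Euc d → ℝ} (hC : Continuous C)
    (hsymm : ∀ x, C (-x) = C x) {r : ℝ}
    (hr : ∀ x, |C x| ≤ r) (u v : Euc d) :
    ∫⁻ w : Euc d, ‖cyclicDensity4 C ![u, w, v + w]‖ₑ ≤
      ENNReal.ofReal (2 * (r * r)) * (4 * ∫⁻ w, ENNReal.ofReal (C w ^ 2)) := by
  have hm : ∀ a : Euc d, Measurable fun w => ENNReal.ofReal (C (w + a) ^ 2) := fun a => by
    have := hC.measurable
    fun_prop
  have htr : ∀ a : Euc d, ∫⁻ w, ENNReal.ofReal (C (w + a) ^ 2) =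
      ∫⁻ w, ENNReal.ofReal (C w ^ 2) := fun a =>
    lintegral_add_right_eq_self (fun w => ENNReal.ofReal (C w ^ 2)) a
  calc ∫⁻ w : Euc d, ‖cyclicDensity4 C ![u, w, v + w]‖ₑ
      ≤ ∫⁻ w : Euc d, ENNReal.ofReal (2 * (r * r)) * (ENNReal.ofReal (C (w + 0) ^ 2) +
          ENNReal.ofReal (C (w + (v - u)) ^ 2) + ENNReal.ofReal (C (w + v) ^ 2) +
          ENNReal.ofReal (C (w + -u) ^ 2)) := by
        refine lintegral_mono fun w => ?_
        rw [Real.enorm_eq_ofReal_abs, ← ENNReal.ofReal_add (by positivity) (by positivity),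
          ← ENNReal.ofReal_add (by positivity) (by positivity),
          ← ENNReal.ofReal_add (by positivity) (by positivity),
          ← ENNReal.ofReal_mul (mul_nonneg zero_le_two (mul_self_nonneg r)), add_zero]
        exact ENNReal.ofReal_le_ofReal (abs_cyclicDensity4_le hsymm hr u v w)
    _ = ENNReal.ofReal (2 * (r * r)) * (4 * ∫⁻ w, ENNReal.ofReal (C w ^ 2)) := by
        rw [lintegral_const_mul _ (by fun_prop), lintegral_add_right _ (hm _),
          lintegral_add_right _ (hm _), lintegral_add_right _ (hm _)]
        simp only [htr]
        ring

theorem lintegral_sq_lt_top {d : ℕ} {C : Euc d → ℝ}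
    (hC : MemLp (fun x => (C x : ℂ)) 2 (volume : Measure (Euc d))) :
    ∫⁻ w, ENNReal.ofReal (C w ^ 2) < ∞ := by
  have hre : MemLp C 2 (volume : Measure (Euc d)) := by simpa using hC.re
  exact hre.integrable_sq.lintegral_lt_top

theorem exists_lintegral_cyclicDensity4_le {d : ℕ} {C : Euc d → ℝ} (hC : Continuous C)
    (hsymm : ∀ x, C (-x) = C x)
    (hL : MemLp (fun x => (C x : ℂ)) 2 (volume : Measure (Euc d))) {r : ℝ}
    (hr : ∀ x, |C x| ≤ r) :
    ∃ M : ℝ≥0, ∀ u v : Euc d, ∫⁻ w : Euc d, ‖cyclicDensity4 C ![u, w, v + w]‖ₑ ≤ M := by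
  have hfin : ENNReal.ofReal (2 * (r * r)) * (4 * ∫⁻ w, ENNReal.ofReal (C w ^ 2)) ≠ ∞ :=
    ENNReal.mul_ne_top ENNReal.ofReal_ne_top
      (ENNReal.mul_ne_top (by simp) (lintegral_sq_lt_top hL).ne)
  exact ⟨_, fun u v => (lintegral_cyclicDensity4_le hC hsymm hr u v).trans
    (ENNReal.coe_toNNReal hfin).ge⟩

/-! ### Almost everywhere statements in the coordinates of the main theorem -/

theorem ae_pair_of_ae {d : ℕ} {p : (Fin 2 → Euc d) → Prop} (h : ∀ᵐ y, p y) :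
    ∀ᵐ q : Euc d × Euc d, p ![q.1, q.2] :=
  (volume_preserving_finTwoArrow (Euc d)).symm.quasiMeasurePreserving.ae h

/-- The shear $(w,v)\mapsto(w,w+v)$ preserves Lebesgue measure, so null sets pull back to null sets;
Fubini then isolates $w$. -/
theorem ae_ae_translate_of_ae {d : ℕ} {p : (Fin 3 → Euc d) → Prop} (h : ∀ᵐ y, p y) :
    ∀ᵐ q : Euc d × Euc d, ∀ᵐ w : Euc d, p ![q.1, w, q.2 + w] := by
  have hmp : MeasurePreserving
      (fun q : Euc d × (Euc d × Euc d) =>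
        (MeasurableEquiv.piFinSuccAbove (fun _ => Euc d) (0 : Fin 3)).symm
          (q.1, ![q.2.1, q.2.1 + q.2.2])) :=
    (volume_preserving_piFinSuccAbove (fun _ => Euc d) (0 : Fin 3)).symm.comp
      ((MeasurePreserving.id volume).prod
        ((volume_preserving_finTwoArrow (Euc d)).symm.comp
          (measurePreserving_prod_add volume volume)))
  have hassoc : MeasurePreserving (fun q : (Euc d × Euc d) × Euc d => (q.1.1, (q.2, q.1.2))) :=
    ((MeasurePreserving.id volume).prod Measure.measurePreserving_swap).comp
      (measurePreserving_prodAssoc volume volume volume)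
  have hae : ∀ᵐ q : (Euc d × Euc d) × Euc d, p ![q.1.1, q.2, q.1.2 + q.2] := by
    filter_upwards [(hmp.comp hassoc).quasiMeasurePreserving.ae h] with q hq
    convert hq using 1
    funext i
    fin_cases i
    · rfl
    · rfl
    · exact add_comm _ _
  exact Measure.ae_ae_of_ae_prod hae

theorem mainTheorem8 {Ω : Type*} [MeasurableSpace Ω] (P : Measure Ω) [IsProbabilityMeasure P]
    {d : ℕ} (hd : 1 ≤ d) (X : PointProcess Ω d) (C : Euc d → ℝ) (ρ : ℝ) (hρ : 0 < ρ)
    (hC : ConditionK C ρ) (hX : IsDPP P X C) (hiso : IsIsotropic P X) :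
    -- the reduced factorial cumulant measures of orders 3 and 4 exist, with explicit densities
    (∃ ν₃, IsReducedFactorialCumulantMeasure P X 2 ν₃ ∧ ν₃.HasDensity (cyclicDensity3 C)) ∧
    (∃ ν₄, IsReducedFactorialCumulantMeasure P X 3 ν₄ ∧ ν₄.HasDensity (cyclicDensity4 C)) ∧
    -- any version of the densities agrees a.e. with the explicit one and is essentially bounded
    (∀ ν₃ c₃, IsReducedFactorialCumulantMeasure P X 2 ν₃ → ν₃.HasDensity c₃ →
      (∀ᵐ y, c₃ y = cyclicDensity3 C y) ∧
      ∀ K : Set ℝ, IsCompact K → ∀ ε : ℝ, 0 < ε →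
        ∃ M : ℝ≥0, ∀ᵐ p : Euc d × Euc d, ‖p.1‖ ∈ dilate K ε → ‖p.2‖ ∈ dilate K ε →
          |c₃ ![p.1, p.2]| ≤ M) ∧
    (∀ ν₄ c₄, IsReducedFactorialCumulantMeasure P X 3 ν₄ → ν₄.HasDensity c₄ →
      (∀ᵐ y, c₄ y = cyclicDensity4 C y) ∧
      ∀ K : Set ℝ, IsCompact K → ∀ ε : ℝ, 0 < ε →
        ∃ M : ℝ≥0, ∀ᵐ p : Euc d × Euc d, ‖p.1‖ ∈ dilate K ε → ‖p.2‖ ∈ dilate K ε →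
          ∫⁻ w : Euc d, ‖c₄ ![p.1, w, p.2 + w]‖ₑ ≤ M) ∧
    -- for the explicit versions the suprema over all `(u, v)` are finite
    (∀ K : Set ℝ, IsCompact K → ∀ ε : ℝ, 0 < ε →
      (∃ M : ℝ≥0, ∀ u v : Euc d, ‖u‖ ∈ dilate K ε → ‖v‖ ∈ dilate K ε →
        |cyclicDensity3 C ![u, v]| ≤ M) ∧
      (∃ M : ℝ≥0, ∀ u v : Euc d, ‖u‖ ∈ dilate K ε → ‖v‖ ∈ dilate K ε →
        ∫⁻ w : Euc d, ‖cyclicDensity4 C ![u, w, v + w]‖ₑ ≤ M)) := by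
  have hbd : ∀ x, |C x| ≤ |C 0| := abs_le_of_isDPP hC.continuous hC.symm hX
  have hcum₃ := detCumulant_kernelMatrix_three hC.symm
  have hcum₄ := detCumulant_kernelMatrix_four hC.symm
  have hc₃ := continuous_cyclicDensity3 hC.continuous
  have hc₄ := continuous_cyclicDensity4 hC.continuous
  have hd₃ := hasDensity_signedMeasureOfDensity hc₃
  have hd₄ := hasDensity_signedMeasureOfDensity hc₄
  have hb₃ : ∀ y, |cyclicDensity3 C y| ≤ ((2 * ‖C 0‖₊ * ‖C 0‖₊ * ‖C 0‖₊ : ℝ≥0) : ℝ) :=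
    abs_cyclicDensity3_le hbd
  obtain ⟨M, hM⟩ := exists_lintegral_cyclicDensity4_le hC.continuous hC.symm hC.memLp hbd
  refine ⟨⟨_, isReducedFactorialCumulantMeasure_of_hasDensity hC.continuous hX hcum₃ hd₃, hd₃⟩,
    ⟨_, isReducedFactorialCumulantMeasure_of_hasDensity hC.continuous hX hcum₄ hd₄, hd₄⟩,
    fun ν c hν hc => ?_, fun ν c hν hc => ?_, fun K _ ε _ => ⟨⟨_, fun u v _ _ => hb₃ _⟩,
      ⟨M, fun u v _ _ => hM u v⟩⟩⟩
  · have hae := density_ae_eq_of_isReducedFactorialCumulantMeasure hC.continuous hX hc₃ hcum₃ hν hc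
    refine ⟨hae, fun K _ ε _ => ⟨2 * ‖C 0‖₊ * ‖C 0‖₊ * ‖C 0‖₊, ?_⟩⟩
    filter_upwards [ae_pair_of_ae hae] with q hq _ _
    rw [hq]
    exact hb₃ _
  · have hae := density_ae_eq_of_isReducedFactorialCumulantMeasure hC.continuous hX hc₄ hcum₄ hν hc
    refine ⟨hae, fun K _ ε _ => ⟨M, ?_⟩⟩
    -- For almost every $(u,v)$ the two densities agree for almost every $w$, so their integrals in
    -- $w$ coincide.
    filter_upwards [ae_ae_translate_of_ae hae] with q hq _ _
    refine (lintegral_congr_ae ?_).trans_le (hM q.1 q.2)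
    filter_upwards [hq] with w hw
    rw [hw]
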